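/- Let $K$ be a local field, i.e. a non-discrete, totally disconnected, locally compact (Hausdorff) topological field, with Haar measure $dx$ on $(K,+)$ and absolute value $|\cdot|$ given by $d(hx)=|h|\,dx$, $|0|=0$. Let $\mathcal S(K)$ be the space of locally constant, compactly supported functions $K\to\mathbb C$. Give it the locally convex inductive limit topology of the subspaces (with the supremum norm) of functions supported in a ball $\{|x|\le\sigma\}$ and constant on the cosets of a ball $\{|x|\le\rho\}$, for $\rho,\sigma>0$. Let $\mathcal S_0(K)=\{f\in\mathcal S(K):\int_K f\,dx=0\}$ with the subspace topology, and let $\mathcal S_0'(K)$ be its continuous dual with the weak-$*$ topology. Write $\langle u|v\rangle=\int_K u\,\overline v\,dx$ on $L^2(K)$ and $\langle\varphi|f\rangle=\varphi(\overline f)$ for $\varphi\in\mathcal S_0'(K)$, $f\in\mathcal S_0(K)$; regard $f\in\mathcal S_0(K)$ as the element $u\mapsto\int_K fu\,dx$ of $\mathcal S_0'(K)$. Let $G=K\rtimes K^*$ with the product topology and multiplication $(x,h)(y,k)=(hy+x,hk)$, and let $(\pi(x,h)f)(y)=|h|^{-1/2}f(h^{-1}(y-x))$. Let $g_1,\dots,g_m\in\mathcal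 S_0(K)$, let $H<G$ be a compact open subgroup and let $R\subset G$ be a system of representatives of the left cosets of $H$, i.e. $G$ is the disjoint union of the sets $rH$, $r\in R$. Put $I=R\times\{1,\dots,m\}$ and give $\mathbb C^I$ the product topology. (a) For every $\alpha\in\mathbb C^I$ the sum $\sum_{(r,j)\in I}\alpha(r,j)\,\pi(r)g_j$ converges unconditionally in the weak-$*$ topology of $\mathcal S_0'(K)$. Its value $S\alpha$ defines a continuous linear operator $S:\mathbb C^I\to\mathcal S_0'(K)$. (b) Let $t_{(r,j),(s,k)}=\langle\pi(s)g_k|\pi(r)g_j\rangle$. For every $(r,j)\in I$ only finitely many $t_{(r,j),(s,k)}$ are nonzero, and $$(T\alpha)(r,j)=\sum_{(s,k)\in I}t_{(r,j),(s,k)}\,\alpha(s,k)$$ defines a continuous linear operator $T:\mathbb C^I\to\mathbb C^I$. Assume that $(\pi(r)g_j)_{(r,j)\in I}$ is a tight frame of $L^2(K)$ with frame constant $C>0$, i.e. $\sum_{(r,j)\in I}|\langle f|\pi(r)g_j\rangle|^2=C\|f\|_2^2$ for all $f\in L^2(K)$, and let $\mathbb C^I_T=\{\alpha\in\mathbb C^I:\alpha=\frac1C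 T\alpha\}$ with the product topology. Then $$W^d:\mathcal S_0'(K)\to\mathbb C^I_T,\qquad \varphi\mapsto(\langle\varphi|\pi(r)g_j\rangle)_{(r,j)\in I}$$ is well defined and is a linear homeomorphism onto $\mathbb C^I_T$. Its inverse is $$\alpha\mapsto\frac1C S\alpha=\frac1C\sum_{(r,j)\in I}\alpha(r,j)\,\pi(r)g_j ,$$ and every $\varphi\in\mathcal S_0'(K)$ has the wavelet expansion $$\varphi=\frac1C\sum_{(r,j)\in I}\langle\varphi|\pi(r)g_j\rangle\,\pi(r)g_j,$$ converging unconditionally in the weak-$*$ topology. -/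

import Mathlib

open MeasureTheory Topology
open scoped ENNReal ComplexConjugate

/-- A (non-archimedean) local field: a topological field which is Hausdorff, locally compact,
totally disconnected and not discrete. -/
class IsTDLocalField (K : Type*) [Field K] [TopologicalSpace K] : Prop extends
    IsTopologicalDivisionRing K, T2Space K, LocallyCompactSpace K, TotallyDisconnectedSpace K where
  not_discrete : ¬ DiscreteTopology K

/-! ### The absolute value -/

/-- The module `|h|` of `h ∈ K^*`: the factor by which multiplication by `h` scales Haar measure,
`μ (h A) = |h| μ A`. -/
noncomputable def unitAbs {K : Type*} [Field K] [TopologicalSpace K] [IsTDLocalField K]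
    (h : Kˣ) : ℝ :=
  (distribHaarChar K h : ℝ)

open Classical in
/-- The absolute value `|x|` on `K`, with `|0| = 0`. -/
noncomputable def localAbs {K : Type*} [Field K] [TopologicalSpace K] [IsTDLocalField K]
    (x : K) : ℝ :=
  if hx : x = 0 then 0 else unitAbs (Units.mk0 x hx)

/-! ### Test functions -/

/-- The locally constant, compactly supported functions, as a subspace of all functions. -/
def testSubmodule (K : Type*) [TopologicalSpace K] : Submodule ℂ (K → ℂ) where
  carrier := {f | IsLocallyConstant f ∧ HasCompactSupport f}
  add_mem' := fun hf hg => ⟨hf.1.add hg.1, hf.2.add hg.2⟩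
  zero_mem' := ⟨IsLocallyConstant.const 0, HasCompactSupport.zero⟩
  smul_mem' := fun c _ hf => ⟨hf.1.comp (fun z => c • z), hf.2.smul_left⟩

/-- The space `𝓢(K)` of test functions. This is a type of its own, so that it does not inherit
the topology of pointwise convergence. -/
def TestFun (K : Type*) [TopologicalSpace K] : Type _ := testSubmodule K

namespace TestFun

section Basic

variable {K : Type*} [TopologicalSpace K]

noncomputable instance : AddCommGroup (TestFun K) := inferInstanceAs (AddCommGroup (testSubmodule K))

noncomputable instance : Module ℂ (TestFun K) := inferInstanceAs (Module ℂ (testSubmodule K))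

instance : CoeFun (TestFun K) (fun _ => K → ℂ) := ⟨fun f => f.1⟩

theorem continuous_coe (f : TestFun K) : Continuous (f : K → ℂ) := f.2.1.continuous

theorem integrable [MeasurableSpace K] [BorelSpace K] (μ : Measure K)
    [IsFiniteMeasureOnCompacts μ] (f : TestFun K) : Integrable (f : K → ℂ) μ :=
  f.continuous_coe.integrable_of_hasCompactSupport f.2.2

end Basic

section LocalField

variable {K : Type*} [Field K] [TopologicalSpace K] [IsTDLocalField K]

/-- The test functions which are supported in the ball `{|x| ≤ σ}` and constant on the cosets of
the ball `{|x| ≤ ρ}`. For `ρ, σ > 0` these balls are exactly the fractional ideals of `K`. -/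
def level (K : Type*) [Field K] [TopologicalSpace K] [IsTDLocalField K] (ρ σ : ℝ) :
    Submodule ℂ (TestFun K) where
  carrier := {f | (∀ x, f x ≠ 0 → localAbs x ≤ σ) ∧
    ∀ x y, localAbs y ≤ ρ → f (x + y) = f x}
  add_mem' := by
    intro f g hf hg
    refine ⟨fun x hx => ?_, fun x y hy => ?_⟩
    · by_contra hσ
      have h1 : f x = 0 := by_contra fun h => hσ (hf.1 x h)
      have h2 : g x = 0 := by_contra fun h => hσ (hg.1 x h)
      apply hx
      change f x + g x = 0
      rw [h1, h2, add_zero]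
    · change f (x + y) + g (x + y) = f x + g x
      rw [hf.2 x y hy, hg.2 x y hy]
  zero_mem' := ⟨fun _ h => (h rfl).elim, fun _ _ _ => rfl⟩
  smul_mem' := by
    intro c f hf
    refine ⟨fun x hx => hf.1 x fun h => hx ?_, fun x y hy => ?_⟩
    · change c * f x = 0
      rw [h, mul_zero]
    · change c * f (x + y) = c * f x
      rw [hf.2 x y hy]

/-- The topology of the supremum norm (uniform convergence on `K`) on a level. -/
@[reducible]
noncomputable def levelTopology (K : Type*) [Field K] [TopologicalSpace K] [IsTDLocalField K] (ρ σ : ℝ) :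
    TopologicalSpace (level K ρ σ) :=
  TopologicalSpace.induced (fun f => UniformFun.ofFun (fun x => f.1 x)) inferInstance

/-- `𝓢(K)` is the locally convex inductive limit of its levels: it carries the finest locally
convex vector space topology which makes all inclusions of the levels continuous. -/
noncomputable instance instTopologicalSpace : TopologicalSpace (TestFun K) :=
  sInf {t : TopologicalSpace (TestFun K) |
    @IsTopologicalAddGroup (TestFun K) t _ ∧
    @ContinuousSMul ℂ (TestFun K) _ _ t ∧
    @LocallyConvexSpace ℝ (TestFun K) _ _ _ _ t ∧
    ∀ ρ σ : ℝ, 0 < ρ → 0 < σ →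
      @Continuous _ _ (levelTopology K ρ σ) t (fun f : level K ρ σ => (f : TestFun K))}

/-- A linear functional which is continuous for the supremum norm on each level is continuous. -/
theorem continuous_of_level (l : TestFun K →ₗ[ℂ] ℂ)
    (h : ∀ ρ σ : ℝ, 0 < ρ → 0 < σ →
      @Continuous _ _ (levelTopology K ρ σ) _ (fun f : level K ρ σ => l f)) :
    Continuous l := by
  refine continuous_iff_le_induced.2 (sInf_le ?_)
  refine ⟨topologicalAddGroup_induced l, continuousSMul_induced l,
    .induced (l.restrictScalars ℝ), fun ρ σ hρ hσ => ?_⟩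
  let _ := levelTopology K ρ σ
  exact continuous_induced_rng.2 (h ρ σ hρ hσ)

variable [MeasurableSpace K] [BorelSpace K]

/-- Integration against a test function. -/
noncomputable def integralAgainst (μ : Measure K) [IsFiniteMeasureOnCompacts μ] (f : TestFun K) :
    TestFun K →ₗ[ℂ] ℂ where
  toFun u := ∫ x, f x * u x ∂μ
  map_add' u v := by
    have H : ∀ w : TestFun K, Integrable (fun x => f x * w x) μ := fun w =>
      (f.continuous_coe.mul w.continuous_coe).integrable_of_hasCompactSupport
        (HasCompactSupport.mul_right f.2.2)
    rw [← integral_add (H u) (H v)]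
    exact integral_congr_ae (.of_forall fun x => mul_add (f x) (u x) (v x))
  map_smul' c u := by
    rw [RingHom.id_apply, smul_eq_mul, ← integral_const_mul]
    exact integral_congr_ae (.of_forall fun x => mul_left_comm (f x) c (u x))

theorem continuous_integralAgainst (μ : Measure K) [IsFiniteMeasureOnCompacts μ] (f : TestFun K) :
    Continuous (integralAgainst μ f) := by
  refine continuous_of_level _ fun ρ σ _ _ => ?_
  let _ := levelTopology K ρ σ
  have hI : Integrable (fun x => f x) μ := f.integrable μ
  have H : ∀ w : TestFun K, Integrable (fun x => f x * w x) μ := fun w =>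
    (f.continuous_coe.mul w.continuous_coe).integrable_of_hasCompactSupport
      (HasCompactSupport.mul_right f.2.2)
  rw [continuous_iff_continuousAt]
  intro u
  have hu : Filter.Tendsto (fun v : level K ρ σ => UniformFun.ofFun (fun x => v.1 x)) (𝓝 u)
      (𝓝 (UniformFun.ofFun (fun x => u.1 x))) :=
    continuous_induced_dom.tendsto u
  rw [UniformFun.tendsto_iff_tendstoUniformly, Metric.tendstoUniformly_iff] at hu
  rw [ContinuousAt, Metric.tendsto_nhds]
  intro ε hε
  set M := ∫ x, ‖f x‖ ∂μ with hM
  have hM0 : 0 ≤ M := integral_nonneg fun x => norm_nonneg _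
  filter_upwards [hu (ε / (M + 1)) (by positivity)] with v hv
  have h1 : integralAgainst μ f v.1 - integralAgainst μ f u.1
      = ∫ x, f x * (v.1 x - u.1 x) ∂μ := by
    change (∫ x, f x * v.1 x ∂μ) - (∫ x, f x * u.1 x ∂μ) = _
    rw [← integral_sub (H v.1) (H u.1)]
    exact integral_congr_ae (.of_forall fun x => (mul_sub _ _ _).symm)
  rw [dist_eq_norm, h1]
  calc ‖∫ x, f x * (v.1 x - u.1 x) ∂μ‖ ≤ ∫ x, ‖f x‖ * (ε / (M + 1)) ∂μ := by
        refine norm_integral_le_of_norm_le (hI.norm.mul_const _) (.of_forall fun x => ?_)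
        rw [norm_mul]
        have := hv x
        rw [dist_comm, dist_eq_norm] at this
        exact mul_le_mul_of_nonneg_left this.le (norm_nonneg _)
    _ = M * (ε / (M + 1)) := by rw [integral_mul_const]
    _ < ε := by
        rw [mul_div_assoc', div_lt_iff₀ (by positivity)]
        nlinarith

end LocalField

end TestFun

/-! ### The affine group and its quasi-regular representation -/

/-- The affine group `K ⋊ K^*`. -/
@[ext]
structure AffGroup (K : Type*) [Field K] where
  /-- the translation part -/
  trans : K
  /-- the dilation part -/
  dil : Kˣ

namespace AffGroup

variable {K : Type*} [Field K]

/-- The group law is `(x, h) (y, k) = (h y + x, h k)`. -/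
instance : Group (AffGroup K) where
  mul a b := ⟨a.dil * b.trans + a.trans, a.dil * b.dil⟩
  one := ⟨0, 1⟩
  inv a := ⟨-((a.dil⁻¹ : Kˣ) * a.trans), a.dil⁻¹⟩
  mul_assoc a b c := by
    apply AffGroup.ext
    · change ((a.dil * b.dil : Kˣ) : K) * c.trans + (a.dil * b.trans + a.trans)
        = a.dil * (b.dil * c.trans + b.trans) + a.trans
      push_cast
      ring
    · exact mul_assoc a.dil b.dil c.dil
  one_mul a := by
    apply AffGroup.ext
    · change ((1 : Kˣ) : K) * a.trans + 0 = a.trans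
      simp
    · exact one_mul a.dil
  mul_one a := by
    apply AffGroup.ext
    · change (a.dil : K) * 0 + a.trans = a.trans
      simp
    · exact mul_one a.dil
  inv_mul_cancel a := by
    apply AffGroup.ext
    · change ((a.dil⁻¹ : Kˣ) : K) * a.trans + -((a.dil⁻¹ : Kˣ) * a.trans) = 0
      simp
    · exact inv_mul_cancel a.dil

/-- The product topology of `K × K^*`. -/
instance [TopologicalSpace K] : TopologicalSpace (AffGroup K) :=
  TopologicalSpace.induced (fun a => (a.trans, a.dil)) inferInstance

end AffGroup

section Representation

variable {K : Type*} [Field K] [TopologicalSpace K] [IsTDLocalField K]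

/-- The homeomorphism `y ↦ h⁻¹ (y - x)` of `K`. -/
def affHomeo (a : AffGroup K) : K ≃ₜ K :=
  (Homeomorph.subRight a.trans).trans (Homeomorph.smul a.dil⁻¹)

/-- The quasi-regular representation on test functions:
`(π(x,h) f)(y) = |h|^{-1/2} f(h⁻¹ (y - x))`. -/
noncomputable def quasiRegular (a : AffGroup K) (f : TestFun K) : TestFun K :=
  ⟨fun y => ((unitAbs a.dil ^ (-(1 / 2) : ℝ) : ℝ) : ℂ) * f ((a.dil⁻¹ : Kˣ) * (y - a.trans)),
    (f.2.1.comp_continuous (affHomeo a).continuous).comp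
      (fun z => ((unitAbs a.dil ^ (-(1 / 2) : ℝ) : ℝ) : ℂ) * z),
    (f.2.2.comp_homeomorph (affHomeo a)).mul_left⟩

/-- Complex conjugation on test functions. -/
noncomputable def conjTest (f : TestFun K) : TestFun K :=
  ⟨fun y => conj (f y), f.2.1.comp conj, f.2.2.comp_left (map_zero _)⟩

variable [MeasurableSpace K] [BorelSpace K] (μ : Measure K) [μ.IsAddHaarMeasure] [μ.Regular]

/-- `𝓢₀(K)`: the test functions with vanishing integral, with the subspace topology. -/
def meanZero : Submodule ℂ (TestFun K) where
  carrier := {f | ∫ x, f x ∂μ = 0}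
  add_mem' := by
    intro f g hf hg
    change ∫ x, f x + g x ∂μ = 0
    rw [integral_add (f.integrable μ) (g.integrable μ), hf, hg, add_zero]
  zero_mem' := integral_zero _ _
  smul_mem' := by
    intro c f hf
    change ∫ x, c * f x ∂μ = 0
    rw [integral_const_mul, hf, mul_zero]

/-- `𝓢₀'(K)`: the continuous linear functionals on `𝓢₀(K)`, with the weak-* topology. -/
abbrev MeanZeroDual : Type _ := WeakDual ℂ (meanZero μ)

theorem integral_inv_mul_eq_zero (h : Kˣ) (f : TestFun K) (hf : ∫ x, f x ∂μ = 0) :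
    ∫ x, f ((h⁻¹ : Kˣ) * x) ∂μ = 0 := by
  let e : K ≃ₜ K := Homeomorph.smul h⁻¹
  have hmap : μ.map e = distribHaarChar K h • μ := by
    ext s hs
    rw [Measure.map_apply e.continuous.measurable hs, Measure.smul_apply,
      Measure.nnreal_smul_coe_apply, distribHaarChar_mul]
    congr 1
    exact Set.preimage_smul_inv h s
  have h1 : ∫ x, f ((h⁻¹ : Kˣ) * x) ∂μ = ∫ x, f x ∂(μ.map e) :=
    (e.measurableEmbedding.integral_map (fun x => f x)).symm
  rw [h1, hmap, integral_smul_nnreal_measure, hf, smul_zero]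

/-- The quasi-regular representation on `𝓢₀(K)`. -/
noncomputable def quasiRegularZero (a : AffGroup K) (f : meanZero μ) : meanZero μ :=
  ⟨quasiRegular a f.1, by
    change ∫ y, ((unitAbs a.dil ^ (-(1 / 2) : ℝ) : ℝ) : ℂ) *
      f.1 ((a.dil⁻¹ : Kˣ) * (y - a.trans)) ∂μ = 0
    rw [integral_const_mul,
      integral_sub_right_eq_self (fun y => f.1 ((a.dil⁻¹ : Kˣ) * y)) a.trans,
      integral_inv_mul_eq_zero μ a.dil f.1 f.2, mul_zero]⟩

/-- Complex conjugation on `𝓢₀(K)`. -/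
noncomputable def conjZero (f : meanZero μ) : meanZero μ :=
  ⟨conjTest f.1, by
    change ∫ y, conj (f.1 y) ∂μ = 0
    rw [integral_conj, f.2, map_zero]⟩

/-- The embedding `𝓢₀(K) → 𝓢₀'(K)`, `f ↦ (u ↦ ∫ f u dμ)`. -/
noncomputable def toDual (f : meanZero μ) : MeanZeroDual μ :=
  StrongDual.toWeakDual
    ⟨(TestFun.integralAgainst μ f.1).comp (meanZero μ).subtype,
      (TestFun.continuous_integralAgainst μ f.1).comp continuous_subtype_val⟩

/-- The extended sesquilinear form `⟨φ | f⟩ = φ(f̄)` for `φ ∈ 𝓢₀'(K)` and `f ∈ 𝓢₀(K)`. -/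
noncomputable def pairing (φ : MeanZeroDual μ) (f : meanZero μ) : ℂ := φ (conjZero μ f)

/-- A test function as an element of `L²(K)`. -/
noncomputable def toL2 (f : meanZero μ) : Lp ℂ 2 μ :=
  (f.1.continuous_coe.memLp_of_hasCompactSupport f.1.2.2).toLp (fun x => f.1 x)

/-- The discrete wavelet system `π(r) g_j`, `(r, j) ∈ R × {1, …, m}`. -/
noncomputable def waveletSystem {m : ℕ} (g : Fin m → meanZero μ) (R : Set (AffGroup K))
    (p : R × Fin m) : meanZero μ :=
  quasiRegularZero μ p.1.1 (g p.2)

/-- The reproducing kernel `t_{(r,j),(s,k)} = ⟨π(s) g_k | π(r) g_j⟩`, where `⟨u | v⟩ = ∫ u v̄ dμ`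
(Mathlib's `inner` is conjugate linear in its first argument). -/
noncomputable def reproducingKernel {m : ℕ} (g : Fin m → meanZero μ) (R : Set (AffGroup K))
    (p q : R × Fin m) : ℂ :=
  inner ℂ (toL2 μ (waveletSystem μ g R p)) (toL2 μ (waveletSystem μ g R q))

end Representation

/-- A family in a Hilbert space is a tight frame with frame constant `C > 0`. -/
def IsTightFrame {ι E : Type*} [NormedAddCommGroup E] [InnerProductSpace ℂ E]
    (v : ι → E) (C : ℝ) : Prop :=
  0 < C ∧ ∀ f : E, HasSum (fun i => ‖inner ℂ (v i) f‖ ^ 2) (C * ‖f‖ ^ 2)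

/-- The subspace `{α : α = C⁻¹ T α}` of `ℂ^ι` (with the product topology). -/
noncomputable def reproducingSubspace {ι : Type*} (T : (ι → ℂ) →L[ℂ] (ι → ℂ)) (C : ℝ) :
    Submodule ℂ (ι → ℂ) where
  carrier := {α | α = (C : ℂ)⁻¹ • T α}
  add_mem' := by
    intro α β hα hβ
    change α + β = (C : ℂ)⁻¹ • T (α + β)
    rw [map_add, smul_add, ← hα, ← hβ]
  zero_mem' := by
    change (0 : ι → ℂ) = (C : ℂ)⁻¹ • T 0
    rw [map_zero, smul_zero]
  smul_mem' := by
    intro c α hα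
    change c • α = (C : ℂ)⁻¹ • T (c • α)
    rw [map_smul, smul_comm, ← hα]

/-! Two finiteness facts reduce the theorem to algebra. Each level of 𝓢(K) is finite dimensional,
since a ball is compact and hence a finite union of cosets of a smaller ball. Every linear
functional on 𝓢₀(K) is therefore continuous, and no estimates are needed
(`continuous_linearMap_submodule`). For f, u in 𝓢₀(K) the coefficient ∫ π(x,h)f · u vanishes outside
a compact subset of the affine group. If |h| is large, π(x,h)f is constant on the support of u; if
|h| is small, u is constant on the support of π(x,h)f. Either way a mean-zero factor kills the
integral. For the remaining h the two supports must meet, which bounds x. A compact set meets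
finitely many cosets of H, so each u has finitely many nonzero coefficients
(`finite_setOf_toDual_waveletSystem_ne_zero`). Hence S is a finite sum when tested on any u, and T =
A S, where A is the analysis operator. The polarised frame identity expands C u as a finite sum
inside 𝓢₀(K) (`IsTightFrame.smul_eq_sum_toDual`). Applying φ gives C⁻¹ S A = id, and then the range
of A is the fixed space of C⁻¹ A S. -/

open Filter
open scoped Pointwise

/-! ### The absolute value and compactness of balls. -/

section AbsoluteValue

variable {K : Type*} [Field K] [TopologicalSpace K] [IsTDLocalField K]

theorem IsTDLocalField.punctured_nhds_neBot : (𝓝[≠] (0 : K)).NeBot := by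
  refine ⟨fun h => IsTDLocalField.not_discrete (K := K) ?_⟩
  exact discreteTopology_of_isOpen_singleton_zero ((isOpen_singleton_iff_punctured_nhds 0).2 h)

theorem localAbs_zero : localAbs (0 : K) = 0 := dif_pos rfl

theorem localAbs_of_ne_zero {x : K} (hx : x ≠ 0) :
    localAbs x = distribHaarChar K (Units.mk0 x hx) := dif_neg hx

theorem localAbs_units (h : Kˣ) : localAbs (h : K) = distribHaarChar K h := by
  rw [localAbs_of_ne_zero h.ne_zero, Units.mk0_val]

theorem localAbs_pos {x : K} (hx : x ≠ 0) : 0 < localAbs x := by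
  rw [localAbs_of_ne_zero hx]
  exact_mod_cast distribHaarChar_pos

theorem localAbs_mul (x y : K) : localAbs (x * y) = localAbs x * localAbs y := by
  rcases eq_or_ne x 0 with rfl | hx
  · rw [zero_mul, localAbs_zero, zero_mul]
  rcases eq_or_ne y 0 with rfl | hy
  · rw [mul_zero, localAbs_zero, mul_zero]
  have := localAbs_units (Units.mk0 x hx * Units.mk0 y hy)
  rw [map_mul, NNReal.coe_mul, ← localAbs_units, ← localAbs_units] at this
  exact this

theorem localAbs_one : localAbs (1 : K) = 1 := by
  simpa using localAbs_units (1 : Kˣ)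

theorem localAbs_inv (x : K) : localAbs x⁻¹ = (localAbs x)⁻¹ := by
  rcases eq_or_ne x 0 with rfl | hx
  · rw [inv_zero, localAbs_zero, inv_zero]
  · refine eq_inv_of_mul_eq_one_left ?_
    rw [← localAbs_mul, inv_mul_cancel₀ hx, localAbs_one]

theorem localAbs_pow (x : K) (n : ℕ) : localAbs (x ^ n) = localAbs x ^ n := by
  induction n with
  | zero => simp [localAbs_one]
  | succ n ih => rw [pow_succ, localAbs_mul, ih, pow_succ]

/-- A single test set of finite positive measure suffices to bound |x|, because multiplication by x
scales all measures by the same factor. -/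
theorem localAbs_le_of_measure_le [MeasurableSpace K] [BorelSpace K] (μ : Measure K)
    [μ.IsAddHaarMeasure] [μ.Regular] {U : Set K} (h0 : μ U ≠ 0) (htop : μ U ≠ ∞) {x : K} {c : ℝ}
    (hc : 0 ≤ c) (h : x ≠ 0 → μ (x • U) ≤ ENNReal.ofReal c * μ U) : localAbs x ≤ c := by
  rcases eq_or_ne x 0 with rfl | hx
  · rwa [localAbs_zero]
  have h1 := h hx
  have h2 : Units.mk0 x hx • U = x • U := rfl
  rw [← h2, ← distribHaarChar_mul μ, ENNReal.mul_le_mul_iff_left h0 htop, ← ENNReal.ofReal_coe_nnreal,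
    ENNReal.ofReal_le_ofReal_iff hc] at h1
  rwa [localAbs_of_ne_zero hx]

theorem eventually_localAbs_le {ρ : ℝ} (hρ : 0 < ρ) : ∀ᶠ x in 𝓝 (0 : K), localAbs x ≤ ρ := by
  borelize K
  let μ : Measure K := Measure.addHaar
  -- Since 0 is not isolated, Haar measure has no atoms. Outer regularity then gives a small open V
  -- around 0, and x U ⊆ V for x near 0.
  have := IsTDLocalField.punctured_nhds_neBot (K := K)
  obtain ⟨U, hUc, hU⟩ := exists_compact_mem_nhds (0 : K)
  have h0 : μ U ≠ 0 := (Measure.measure_pos_of_mem_nhds μ hU).ne'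
  have htop : μ U ≠ ∞ := hUc.measure_lt_top.ne
  have hpos : 0 < ENNReal.ofReal ρ * μ U :=
    ENNReal.mul_pos (ENNReal.ofReal_pos.2 hρ).ne' h0
  obtain ⟨V, h0V, hVo, hV⟩ := Set.exists_isOpen_lt_of_lt (μ := μ) ({0} : Set K)
    (ENNReal.ofReal ρ * μ U) (by simpa using hpos)
  obtain ⟨W, hW, hUW⟩ := exists_mem_nhds_zero_mul_subset hUc (hVo.mem_nhds (h0V rfl))
  filter_upwards [hW] with x hx
  refine localAbs_le_of_measure_le μ h0 htop hρ.le fun _ => (measure_mono ?_).trans hV.le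
  rintro _ ⟨u, hu, rfl⟩
  exact hUW ⟨u, hu, x, hx, mul_comm u x⟩

theorem IsCompact.exists_localAbs_le {L : Set K} (hL : IsCompact L) :
    ∃ M : ℝ, ∀ x ∈ L, localAbs x ≤ M := by
  borelize K
  let μ : Measure K := Measure.addHaar
  obtain ⟨U, hUc, hU⟩ := exists_compact_mem_nhds (0 : K)
  have h0 : μ U ≠ 0 := (Measure.measure_pos_of_mem_nhds μ hU).ne'
  have htop : μ U ≠ ∞ := hUc.measure_lt_top.ne
  have hLU : μ (L * U) ≠ ∞ := (hL.mul hUc).measure_lt_top.ne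
  refine ⟨(μ (L * U) / μ U).toReal, fun x hx => ?_⟩
  refine localAbs_le_of_measure_le μ h0 htop ENNReal.toReal_nonneg fun _ => ?_
  rw [ENNReal.ofReal_toReal (ENNReal.div_ne_top hLU h0), ENNReal.div_mul_cancel h0 htop]
  refine measure_mono ?_
  rintro _ ⟨u, hu, rfl⟩
  exact ⟨x, hx, u, hu, rfl⟩

/-- A local field contains a nonzero topologically nilpotent element. -/
theorem IsTDLocalField.exists_tendsto_pow_zero :
    ∃ r : K, r ≠ 0 ∧ Tendsto (fun n : ℕ => r ^ n) atTop (𝓝 0) := by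
  have := IsTDLocalField.punctured_nhds_neBot (K := K)
  obtain ⟨V, hVc, hV⟩ := exists_compact_mem_nhds (0 : K)
  obtain ⟨W, hW, hVW⟩ := exists_mem_nhds_zero_mul_subset hVc hV
  -- V r ⊆ V keeps all powers of r in the compact set V, so it is enough to exclude nonzero cluster
  -- points.
  have hev : ∀ᶠ r in 𝓝 (0 : K), (r ∈ V ∧ r ∈ W) ∧ localAbs r ≤ 1 / 2 :=
    (Filter.Eventually.and hV hW).and (eventually_localAbs_le one_half_pos)
  obtain ⟨r, ⟨⟨hrV, hrW⟩, hr2⟩, hr0⟩ :=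
    ((hev.filter_mono (nhdsWithin_le_nhds (s := {0}ᶜ))).and self_mem_nhdsWithin).exists
  refine ⟨r, hr0, ?_⟩
  have hmem : ∀ n : ℕ, r ^ (n + 1) ∈ V := by
    intro n
    induction n with
    | zero => simpa using hrV
    | succ n ih => exact hVW ⟨_, ih, r, hrW, (pow_succ _ _).symm⟩
  refine hVc.tendsto_nhds_of_unique_mapClusterPt ?_ fun y _ hy => ?_
  · filter_upwards [eventually_ge_atTop 1] with n hn
    obtain ⟨k, rfl⟩ := Nat.exists_eq_add_of_le' hn
    exact hmem k
  · by_contra hy0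
    -- Near a nonzero cluster point the inverses r⁻ⁿ would return infinitely often to a compact set,
    -- where |·| is bounded, although |r⁻ⁿ| ≥ 2ⁿ.
    obtain ⟨P, hPc, hP⟩ := exists_compact_mem_nhds y⁻¹
    obtain ⟨M, hM⟩ := hPc.exists_localAbs_le
    have hf := mapClusterPt_iff_frequently.1 hy _ ((continuousAt_inv₀ hy0).preimage_mem_nhds hP)
    obtain ⟨N, hN⟩ := pow_unbounded_of_one_lt M one_lt_two
    obtain ⟨n, hn, hnP⟩ := (hf.and_eventually (eventually_ge_atTop N)).exists
    have h1 := hM _ hn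
    rw [localAbs_inv, localAbs_pow, ← inv_pow] at h1
    have h2 : (2 : ℝ) ≤ (localAbs r)⁻¹ := by
      rw [le_inv_comm₀ two_pos (localAbs_pos hr0)]
      simpa using hr2
    have h3 : (2 : ℝ) ^ N ≤ (localAbs r)⁻¹ ^ n :=
      (pow_le_pow_right₀ one_le_two hnP).trans (pow_le_pow_left₀ zero_le_two h2 n)
    linarith

/-- In a local field inversion maps the complement of a neighbourhood of `0` into a compact set. -/
theorem IsTDLocalField.exists_isCompact_of_inv_notMem {N : Set K} (hN : N ∈ 𝓝 0) :
    ∃ D : Set K, IsCompact D ∧ ∀ x, x ≠ 0 → x⁻¹ ∉ N → x ∈ D := by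
  obtain ⟨r, hr0, hr⟩ := IsTDLocalField.exists_tendsto_pow_zero (K := K)
  obtain ⟨V, hVc, hV⟩ := exists_compact_mem_nhds (0 : K)
  have hrV : r • interior V ∈ 𝓝 (0 : K) :=
    (set_smul_mem_nhds_zero_iff hr0).2 (interior_mem_nhds.2 hV)
  -- A compact shell avoiding 0: every nonzero a outside V is moved into it by the first power of r
  -- that brings a into V.
  have hL0 : IsCompact (V \ r • interior V) := hVc.diff (isOpen_interior.smul₀ hr0)
  have hL : IsCompact ((fun x => x⁻¹) '' (V \ r • interior V)) :=
    hL0.image_of_continuousOn <| continuousOn_inv₀.mono fun b hb h0 =>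
      hb.2 ((show b = 0 from h0) ▸ mem_of_mem_nhds hrV)
  obtain ⟨W, hW, hLW⟩ := exists_mem_nhds_zero_mul_subset hL hN
  obtain ⟨M, hM⟩ := eventually_atTop.1 (hr.eventually_mem hW)
  refine ⟨⋃ n ∈ Set.Iic M, (r ^ n)⁻¹ • V,
    (Set.finite_Iic M).isCompact_biUnion fun n _ => hVc.smul _, fun a ha haN => ?_⟩
  have hex : ∃ n : ℕ, r ^ n * a ∈ V := by
    have h1 : Tendsto (fun n : ℕ => r ^ n * a) atTop (𝓝 0) := by
      simpa using hr.mul_const a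
    exact (h1.eventually_mem hV).exists
  classical
  -- For the least n with rⁿ a ∈ V, n > M would put rⁿ a in the shell and rⁿ in W, so a⁻¹ = (rⁿ a)⁻¹
  -- rⁿ would lie in N. Thus n ≤ M.
  have hn := Nat.find_spec hex
  have hmin : ∀ k < Nat.find hex, r ^ k * a ∉ V := fun k => Nat.find_min hex
  generalize Nat.find hex = n at hn hmin
  have hle : n ≤ M := by
    by_contra hlt
    obtain ⟨k, rfl⟩ := Nat.exists_eq_add_of_le' (Nat.one_le_of_lt (not_le.1 hlt))
    refine haN (hLW ⟨(r ^ (k + 1) * a)⁻¹, ⟨_, ⟨hn, ?_⟩, rfl⟩, r ^ (k + 1), hM _ (by omega), ?_⟩)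
    · rintro ⟨v, hv, hva⟩
      refine hmin k (Nat.lt_succ_self k) ?_
      have h2 : r ^ k * a = v := by
        apply mul_left_cancel₀ hr0
        rw [← smul_eq_mul r v]
        rw [show r • v = r ^ (k + 1) * a from hva, pow_succ']
        ring
      exact h2 ▸ interior_subset hv
    · have : r ^ (k + 1) ≠ 0 := pow_ne_zero _ hr0
      change (r ^ (k + 1) * a)⁻¹ * r ^ (k + 1) = a⁻¹
      field_simp
  refine Set.mem_biUnion (Set.mem_Iic.2 hle) ⟨_, hn, ?_⟩
  have : r ^ n ≠ 0 := pow_ne_zero _ hr0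
  change (r ^ n)⁻¹ * (r ^ n * a) = a
  field_simp

theorem exists_isCompact_localAbs_le {σ : ℝ} (hσ : 0 < σ) :
    ∃ D : Set K, IsCompact D ∧ ∀ x, localAbs x ≤ σ → x ∈ D := by
  -- The radius (σ + 1)⁻¹ is strictly below σ⁻¹, so nonzero x with |x| ≤ σ have x⁻¹ outside this
  -- ball.
  obtain ⟨D, hD, h⟩ := IsTDLocalField.exists_isCompact_of_inv_notMem
    (eventually_localAbs_le (K := K) (inv_pos.2 (add_pos hσ one_pos)))
  refine ⟨insert 0 D, hD.insert 0, fun x hx => ?_⟩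
  rcases eq_or_ne x 0 with rfl | h0
  · exact Set.mem_insert _ _
  · refine Set.mem_insert_of_mem _ (h x h0 fun hmem => ?_)
    have h1 : localAbs x⁻¹ ≤ (σ + 1)⁻¹ := hmem
    rw [localAbs_inv, inv_le_inv₀ (localAbs_pos h0) (by linarith)] at h1
    linarith

end AbsoluteValue

/-! ### Automatic continuity of linear functionals. -/

section Functionals

variable {K : Type*} [Field K] [TopologicalSpace K] [IsTDLocalField K]

/-- Each level is finite dimensional, so every linear functional on `𝓢(K)` is continuous. -/
theorem TestFun.continuous_linearMap (l : TestFun K →ₗ[ℂ] ℂ) : Continuous l := by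
  refine TestFun.continuous_of_level l fun ρ σ hρ hσ => ?_
  let _ := TestFun.levelTopology K ρ σ
  obtain ⟨D, hDc, hD⟩ := exists_isCompact_localAbs_le (K := K) hσ
  obtain ⟨t, -, ht⟩ := hDc.elim_nhds_subcover (fun x => {z | localAbs (z - x) ≤ ρ}) fun x _ => by
    have : Tendsto (fun z => z - x) (𝓝 x) (𝓝 0) := by
      simpa using (continuous_sub_right x).tendsto x
    exact this (eventually_localAbs_le hρ)
  -- Sampling at finitely many coset representatives determines a function of the level, so l
  -- factors through the finite-dimensional space ℂ^t.
  let ev : TestFun.level K ρ σ →ₗ[ℂ] (t → ℂ) :=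
    { toFun := fun f x => f.1 x
      map_add' := fun _ _ => rfl
      map_smul' := fun _ _ => rfl }
  have hev : ev.ker = ⊥ := by
    refine LinearMap.ker_eq_bot'.2 fun f hf => Subtype.ext (Subtype.ext (funext fun x => ?_))
    change f.1 x = 0
    by_contra hx
    obtain ⟨y, hy, hxy⟩ := Set.mem_iUnion₂.1 (ht (hD x (f.2.1 x hx)))
    have h1 := f.2.2 y (x - y) hxy
    rw [add_sub_cancel] at h1
    exact hx (h1.trans (congrFun hf ⟨y, hy⟩))
  obtain ⟨s, hs⟩ := LinearMap.exists_leftInverse_of_injective ev hev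
  have hcont : Continuous ev := continuous_pi fun x =>
    (UniformFun.uniformContinuous_eval ℂ (x : K)).continuous.comp continuous_induced_dom
  have heq : (fun f : TestFun.level K ρ σ => l f) =
      (l ∘ₗ (TestFun.level K ρ σ).subtype ∘ₗ s) ∘ ev := by
    funext f
    have : s (ev f) = f := LinearMap.congr_fun hs f
    simp [this]
  rw [heq]
  exact (LinearMap.continuous_on_pi _).comp hcont

/-- A purely algebraic extension to 𝓢(K) is already continuous. -/
theorem continuous_linearMap_submodule (M : Submodule ℂ (TestFun K)) (l : M →ₗ[ℂ] ℂ) :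
    Continuous l := by
  obtain ⟨l', hl'⟩ := LinearMap.exists_extend l
  rw [← hl']
  exact (TestFun.continuous_linearMap l').comp continuous_subtype_val

end Functionals

/-! ### Compact sets and cosets in the affine group. -/

section AffineTopology

variable {K : Type*} [Field K] [TopologicalSpace K]

/-- The topology of K^* comes from h ↦ (h, h⁻¹), whose image {ab = 1} is closed. Hence both h and
h⁻¹ have to be confined. -/
theorem Units.isCompact_setOf_val_inv_mem [ContinuousMul K] [T2Space K] {D D' : Set K}
    (hD : IsCompact D) (hD' : IsCompact D') :
    IsCompact {h : Kˣ | (h : K) ∈ D ∧ ((h⁻¹ : Kˣ) : K) ∈ D'} := by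
  have hrange : Set.range (fun h : Kˣ => ((h : K), ((h⁻¹ : Kˣ) : K))) = {p | p.1 * p.2 = 1} := by
    ext ⟨a, b⟩
    constructor
    · rintro ⟨h, hh⟩
      rw [← hh]
      exact h.mul_inv
    · intro hab
      exact ⟨⟨a, b, hab, (mul_comm b a).trans hab⟩, rfl⟩
  have hind : IsInducing (fun h : Kˣ => ((h : K), ((h⁻¹ : Kˣ) : K))) :=
    ((Homeomorph.refl K).prodCongr MulOpposite.opHomeomorph.symm).isInducing.comp
      Units.isEmbedding_embedProduct.isInducing
  refine hind.isCompact_preimage ?_ (hD.prod hD')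
  rw [hrange]
  exact isClosed_eq (continuous_fst.mul continuous_snd) continuous_const

theorem AffGroup.isCompact_setOf [ContinuousMul K] [T2Space K] {X D D' : Set K}
    (hX : IsCompact X) (hD : IsCompact D) (hD' : IsCompact D') :
    IsCompact {a : AffGroup K |
      a.trans ∈ X ∧ (a.dil : K) ∈ D ∧ ((a.dil⁻¹ : Kˣ) : K) ∈ D'} := by
  have hind : IsInducing (fun a : AffGroup K => (a.trans, a.dil)) := ⟨rfl⟩
  have hsurj : Function.Surjective (fun a : AffGroup K => (a.trans, a.dil)) :=
    fun p => ⟨⟨p.1, p.2⟩, rfl⟩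
  refine hind.isCompact_preimage ?_ (hX.prod (Units.isCompact_setOf_val_inv_mem hD hD'))
  rw [hsurj.range_eq]
  exact isClosed_univ

theorem AffGroup.continuous_mul_left [IsTopologicalRing K] (a : AffGroup K) :
    Continuous (fun b : AffGroup K => a * b) := by
  have hc : Continuous (fun b : AffGroup K => (b.trans, b.dil)) := continuous_induced_dom
  exact continuous_induced_rng.2 <|
    ((continuous_const.mul hc.fst).add continuous_const).prodMk (continuous_const.mul hc.snd)

/-- A compact set meets only finitely many left cosets of an open subgroup. -/
theorem AffGroup.finite_setOf_mem [IsTopologicalRing K] {H : Subgroup (AffGroup K)}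
    (hHo : IsOpen (H : Set (AffGroup K))) {R : Set (AffGroup K)}
    (hR : Subgroup.IsComplement R (H : Set (AffGroup K))) {A : Set (AffGroup K)}
    (hA : IsCompact A) : {r : R | (r : AffGroup K) ∈ A}.Finite := by
  obtain ⟨t, -, ht⟩ := hA.elim_nhds_subcover (fun a => {b | a⁻¹ * b ∈ H}) fun a _ =>
    (hHo.preimage (AffGroup.continuous_mul_left a⁻¹)).mem_nhds (by simp [H.one_mem])
  have hcover : {r : R | (r : AffGroup K) ∈ A} ⊆ ⋃ a ∈ t, {r : R | a⁻¹ * (r : AffGroup K) ∈ H} := by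
    intro r hr
    obtain ⟨a, ha, h⟩ := Set.mem_iUnion₂.1 (ht hr)
    exact Set.mem_iUnion₂.2 ⟨a, ha, h⟩
  refine (t.finite_toSet.biUnion fun a _ => Set.Subsingleton.finite ?_).subset hcover
  intro r hr s hs
  have hrs : (r : AffGroup K)⁻¹ * s ∈ H := by
    simpa [mul_assoc] using H.mul_mem (H.inv_mem hr) hs
  -- s · 1 = r · (r⁻¹ s) are two factorisations of the same element, so r = s.
  have := hR.1 (a₁ := (s, ⟨1, H.one_mem⟩)) (a₂ := (r, ⟨_, hrs⟩)) (by simp)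
  exact (congrArg Prod.fst this).symm

end AffineTopology

/-! ### Compact support of the wavelet transform. -/

/-- If one of two functions is constant on the support of the other, and the other one has mean
zero, then their product has mean zero. -/
theorem integral_mul_eq_zero_of_forall_eq {X : Type*} [MeasurableSpace X] (μ : Measure X)
    {f u : X → ℂ} (hu : ∫ y, u y ∂μ = 0)
    (h : ∀ y y', u y ≠ 0 → u y' ≠ 0 → f y = f y') : ∫ y, f y * u y ∂μ = 0 := by
  by_cases hex : ∃ y₀, u y₀ ≠ 0
  · obtain ⟨y₀, hy₀⟩ := hex
    have : (fun y => f y * u y) = fun y => f y₀ * u y := by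
      funext y
      by_cases hy : u y = 0
      · rw [hy, mul_zero, mul_zero]
      · rw [h y y₀ hy hy₀]
    rw [this, integral_const_mul, hu, mul_zero]
  · push Not at hex
    simp [hex]

section CompactSupport

variable {K : Type*} [Field K] [TopologicalSpace K] [IsTDLocalField K]

/-- A test function is invariant under a neighbourhood of `0`. -/
theorem TestFun.eventually_forall_add_eq (f : TestFun K) :
    ∀ᶠ v in 𝓝 (0 : K), ∀ x, f (x + v) = f x := by
  have h1 : ∀ᶠ v in 𝓝 (0 : K), ∀ x ∈ tsupport f, f (x + v) = f x := by
    refine IsCompact.eventually_forall_of_forall_eventually f.2.2 fun x _ => ?_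
    have h2 : Tendsto (fun z : K × K => z.2 + z.1) (𝓝 (0, x)) (𝓝 x) := by
      have : Continuous (fun z : K × K => z.2 + z.1) := by fun_prop
      simpa using this.tendsto (0, x)
    have h3 : Tendsto (fun z : K × K => z.2) (𝓝 (0, x)) (𝓝 x) := continuous_snd.tendsto (0, x)
    filter_upwards [h2.eventually (f.2.1.eventually_eq x), h3.eventually (f.2.1.eventually_eq x)]
      with z h h' using h.trans h'.symm
  -- The shift by -v handles points outside the support that v moves into it.
  have h4 : Tendsto (fun v : K => -v) (𝓝 0) (𝓝 0) := by
    simpa using (continuous_neg (G := K)).tendsto 0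
  filter_upwards [h1, h4.eventually h1] with v hv hv' x
  by_cases hx : x ∈ tsupport f
  · exact hv x hx
  by_cases hxv : x + v ∈ tsupport f
  · simpa using (hv' _ hxv).symm
  · exact (image_eq_zero_of_notMem_tsupport hxv).trans (image_eq_zero_of_notMem_tsupport hx).symm

/-- Applied with p the invariance of a test function under a shift: the function is then constant on
every translate of t L for small t. -/
theorem eventually_forall_mul_sub {L : Set K} (hL : IsCompact L) {p : K → Prop}
    (hp : ∀ᶠ v in 𝓝 (0 : K), p v) : ∀ᶠ t in 𝓝 (0 : K), ∀ x ∈ L, ∀ y ∈ L, p (t * (x - y)) := by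
  have hLL : IsCompact (L - L) := sub_eq_add_neg L L ▸ hL.add hL.neg
  obtain ⟨W, hW, hLW⟩ := exists_mem_nhds_zero_mul_subset hLL hp
  filter_upwards [hW] with t ht x hx y hy
  exact hLW ⟨_, Set.sub_mem_sub hx hy, t, ht, mul_comm _ _⟩

variable [MeasurableSpace K] [BorelSpace K] (μ : Measure K) [μ.IsAddHaarMeasure] [μ.Regular]

/-- The wavelet transform of a function in `𝓢₀(K)` with respect to a function in `𝓢₀(K)` has
relatively compact support in the affine group. -/
theorem exists_isCompact_toDual_quasiRegularZero_ne_zero (f u : meanZero μ) :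
    ∃ A : Set (AffGroup K), IsCompact A ∧
      ∀ a, toDual μ (quasiRegularZero μ a f) u ≠ 0 → a ∈ A := by
  have hfc : IsCompact (tsupport f.1) := f.1.2.2
  have huc : IsCompact (tsupport u.1) := u.1.2.2
  obtain ⟨D', hD'c, hD'⟩ := IsTDLocalField.exists_isCompact_of_inv_notMem
    (eventually_forall_mul_sub hfc u.1.eventually_forall_add_eq)
  obtain ⟨D, hDc, hD⟩ := IsTDLocalField.exists_isCompact_of_inv_notMem
    (eventually_forall_mul_sub huc f.1.eventually_forall_add_eq)
  have hX : IsCompact (tsupport u.1 - D * tsupport f.1) :=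
    sub_eq_add_neg (tsupport u.1) _ ▸ huc.add (hDc.mul hfc).neg
  refine ⟨_, AffGroup.isCompact_setOf hX hDc hD'c, fun a ha => ?_⟩
  -- Large dilations: the dilated f is constant on the support of u, which has mean zero.
  have hdil : (a.dil : K) ∈ D := by
    refine hD _ a.dil.ne_zero fun hmem => ha ?_
    refine integral_mul_eq_zero_of_forall_eq μ u.2 fun y y' hy hy' => ?_
    have h1 := hmem y (subset_tsupport _ hy) y' (subset_tsupport _ hy')
      ((a.dil⁻¹ : Kˣ) * (y' - a.trans))
    change _ * f.1 _ = _ * f.1 _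
    rw [← h1, Units.val_inv_eq_inv_val]
    ring_nf
  -- Small dilations: the roles are exchanged, and π(a)f is the mean-zero factor.
  have hinv : ((a.dil⁻¹ : Kˣ) : K) ∈ D' := by
    refine hD' _ (a.dil⁻¹).ne_zero fun hmem => ha ?_
    change ∫ y, quasiRegular a f.1 y * u.1 y ∂μ = 0
    simp_rw [mul_comm (quasiRegular a f.1 _)]
    refine integral_mul_eq_zero_of_forall_eq μ (quasiRegularZero μ a f).2 fun y y' hy hy' => ?_
    have h1 := hmem _ (subset_tsupport _ (right_ne_zero_of_mul hy))
      _ (subset_tsupport _ (right_ne_zero_of_mul hy')) y'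
    rw [← h1, Units.val_inv_eq_inv_val, inv_inv, ← mul_sub, mul_inv_cancel_left₀ a.dil.ne_zero]
    ring_nf
  refine ⟨?_, hdil, hinv⟩
  -- A common point y of the two supports gives x = y - h z with z in the support of f.
  have hex : ∃ y, quasiRegular a f.1 y * u.1 y ≠ 0 := by
    by_contra! hall
    refine ha ?_
    change ∫ y, quasiRegular a f.1 y * u.1 y ∂μ = 0
    simp [hall]
  obtain ⟨y, hy⟩ := hex
  refine ⟨y, subset_tsupport _ (right_ne_zero_of_mul hy), _,
    ⟨_, hdil, _, subset_tsupport _ (right_ne_zero_of_mul (left_ne_zero_of_mul hy)), rfl⟩, ?_⟩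
  simp

theorem finite_setOf_toDual_waveletSystem_ne_zero {m : ℕ} (g : Fin m → meanZero μ)
    {H : Subgroup (AffGroup K)} (hHo : IsOpen (H : Set (AffGroup K))) {R : Set (AffGroup K)}
    (hR : Subgroup.IsComplement R (H : Set (AffGroup K))) (u : meanZero μ) :
    {p : R × Fin m | toDual μ (waveletSystem μ g R p) u ≠ 0}.Finite := by
  choose A hAc hA using fun j => exists_isCompact_toDual_quasiRegularZero_ne_zero μ (g j) u
  refine (Set.finite_iUnion fun j =>
    (AffGroup.finite_setOf_mem hHo hR (hAc j)).image fun r => (r, j)).subset ?_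
  rintro ⟨r, j⟩ hrj
  exact Set.mem_iUnion.2 ⟨j, r, hA j r hrj, rfl⟩

end CompactSupport

/-! ### Tight frames in a Hilbert space. -/

section TightFrame

variable {ι E : Type*} [NormedAddCommGroup E] [InnerProductSpace ℂ E] {v : ι → E} {C : ℝ}

/-- Polarisation of the frame identity. -/
theorem IsTightFrame.hasSum_inner_mul_inner (h : IsTightFrame v C) (x y : E) :
    HasSum (fun i => inner ℂ (v i) y * inner ℂ x (v i)) (C * inner ℂ x y) := by
  have hz : ∀ z : E, HasSum (fun i => (‖inner ℂ (v i) z‖ : ℂ) ^ 2) (C * (‖z‖ : ℂ) ^ 2) :=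
    fun z => by
      have h1 := (h.2 z).mapL Complex.ofRealCLM
      simpa only [Complex.ofRealCLM_apply, Complex.ofReal_mul, Complex.ofReal_pow] using h1
  have hs := (((hz (x + y)).sub (hz (x - y))).add
    (((hz (x - Complex.I • y)).sub (hz (x + Complex.I • y))).mul_right Complex.I)).div_const 4
  have hterm : ∀ i, inner ℂ (v i) y * inner ℂ x (v i) =
      ((‖inner ℂ (v i) (x + y)‖ : ℂ) ^ 2 - (‖inner ℂ (v i) (x - y)‖ : ℂ) ^ 2 +
        ((‖inner ℂ (v i) (x - Complex.I • y)‖ : ℂ) ^ 2 -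
          (‖inner ℂ (v i) (x + Complex.I • y)‖ : ℂ) ^ 2) * Complex.I) / 4 := by
    intro i
    have h1 : inner ℂ (v i) y * inner ℂ x (v i) = inner ℂ (inner ℂ (v i) x) (inner ℂ (v i) y) := by
      rw [RCLike.inner_apply, inner_conj_symm]
    rw [h1, inner_eq_sum_norm_sq_div_four]
    simp
  have hsum : (C : ℂ) * inner ℂ x y =
      (C * (‖x + y‖ : ℂ) ^ 2 - C * (‖x - y‖ : ℂ) ^ 2 +
        (C * (‖x - Complex.I • y‖ : ℂ) ^ 2 - C * (‖x + Complex.I • y‖ : ℂ) ^ 2) *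
          Complex.I) / 4 := by
    rw [inner_eq_sum_norm_sq_div_four]
    simp only [RCLike.I_to_complex, Complex.coe_algebraMap]
    ring
  simp_rw [hterm]
  rw [hsum]
  exact hs

/-- With finitely many nonzero coefficients, the weak reconstruction formula is an equality of
vectors, with no limit to take. -/
theorem IsTightFrame.smul_eq_sum (h : IsTightFrame v C) {x : E} {s : Finset ι}
    (hs : ∀ i ∉ s, inner ℂ (v i) x = 0) : (C : ℂ) • x = ∑ i ∈ s, inner ℂ (v i) x • v i := by
  refine ext_inner_left ℂ fun z => ?_
  rw [inner_smul_right, inner_sum]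
  simp_rw [inner_smul_right]
  exact (h.hasSum_inner_mul_inner z x).unique
    (hasSum_sum_of_ne_finset_zero fun i hi => by rw [hs i hi, zero_mul])

end TightFrame

/-! ### Weak-* sums and the synthesis operator. -/

theorem WeakDual.hasSum_iff {ι E : Type*} [AddCommGroup E] [Module ℂ E] [TopologicalSpace E]
    {f : ι → WeakDual ℂ E} {φ : WeakDual ℂ E} :
    HasSum f φ ↔ ∀ u, HasSum (fun i => f i u) (φ u) := by
  refine tendsto_iff_forall_eval_tendsto_topDualPairing.trans (forall_congr' fun u => ?_)
  have hsum : ∀ s : Finset ι, (∑ i ∈ s, f i : WeakDual ℂ E) u = ∑ i ∈ s, f i u := by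
    classical
    intro s
    induction s using Finset.induction_on with
    | empty => rfl
    | insert i s hi ih =>
      rw [Finset.sum_insert hi, Finset.sum_insert hi, ← ih]
      rfl
  exact tendsto_congr hsum

section Synthesis

variable {ι E : Type*} [AddCommGroup E] [Module ℂ E] [TopologicalSpace E]
  (hE : ∀ l : E →ₗ[ℂ] ℂ, Continuous l) (w : ι → WeakDual ℂ E)
  (hw : ∀ u, {i | w i u ≠ 0}.Finite)

theorem support_mul_finite (hw : ∀ u, {i | w i u ≠ 0}.Finite) (α : ι → ℂ) (u : E) :
    (Function.support fun i => α i * w i u).Finite :=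
  (hw u).subset fun _ => right_ne_zero_of_mul

/-- The synthesis operator `α ↦ ∑ α i • w i` of a family of functionals only finitely many of
which are nonzero at any given vector. -/
noncomputable def synthesis : (ι → ℂ) →L[ℂ] WeakDual ℂ E where
  toFun α := StrongDual.toWeakDual
    (let l : E →ₗ[ℂ] ℂ :=
      { toFun := fun u => ∑ᶠ i, α i * w i u
        map_add' := fun u v => by
          simp_rw [map_add, mul_add]
          exact finsum_add_distrib (support_mul_finite w hw α u) (support_mul_finite w hw α v)
        map_smul' := fun c u => by
          simp_rw [map_smul, smul_eq_mul, mul_left_comm _ c]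
          exact (mul_finsum _ _).symm }
    ⟨l, hE l⟩)
  map_add' α β := by
    refine DFunLike.ext _ _ fun u => ?_
    change ∑ᶠ i, (α i + β i) * w i u = (∑ᶠ i, α i * w i u) + ∑ᶠ i, β i * w i u
    simp_rw [add_mul]
    exact finsum_add_distrib (support_mul_finite w hw α u) (support_mul_finite w hw β u)
  map_smul' c α := by
    refine DFunLike.ext _ _ fun u => ?_
    change ∑ᶠ i, (c * α i) * w i u = c * ∑ᶠ i, α i * w i u
    simp_rw [mul_assoc]
    exact (mul_finsum _ _).symm
  cont := by
    refine WeakDual.continuous_of_continuous_eval fun u => ?_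
    change Continuous fun α : ι → ℂ => ∑ᶠ i, α i * w i u
    -- The finite index set depends on u but not on α, so the value at u involves only finitely many
    -- coordinates of α.
    have : (fun α : ι → ℂ => ∑ᶠ i, α i * w i u) =
        fun α => ∑ i ∈ (hw u).toFinset, α i * w i u := by
      funext α
      exact finsum_eq_sum_of_support_subset _ fun i hi => by
        simpa using right_ne_zero_of_mul hi
    rw [this]
    fun_prop

theorem hasSum_synthesis (α : ι → ℂ) : HasSum (fun i => α i • w i) (synthesis hE w hw α) := by
  refine WeakDual.hasSum_iff.2 fun u => ?_
  have h1 : synthesis hE w hw α u = ∑ i ∈ (hw u).toFinset, α i * w i u :=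
    finsum_eq_sum_of_support_subset _ fun i hi => by simpa using right_ne_zero_of_mul hi
  rw [h1]
  exact hasSum_sum_of_ne_finset_zero fun i hi => by
    have : w i u = 0 := by simpa using hi
    change α i * w i u = 0
    rw [this, mul_zero]

end Synthesis

/-! ### Finite expansions in 𝓢₀(K) and the analysis operator. -/

section Expansion

variable {K : Type*} [Field K] [TopologicalSpace K] [IsTDLocalField K]
  [MeasurableSpace K] [BorelSpace K] (μ : Measure K) [μ.IsAddHaarMeasure] [μ.Regular]

theorem conjZero_conjZero (f : meanZero μ) : conjZero μ (conjZero μ f) = f :=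
  Subtype.ext (Subtype.ext (funext fun x => Complex.conj_conj (f.1 x)))

/-- Complex conjugation on `𝓢₀(K)` as a conjugate linear map. -/
noncomputable def conjZeroₛₗ : meanZero μ →ₗ⋆[ℂ] meanZero μ where
  toFun := conjZero μ
  map_add' f g := Subtype.ext (Subtype.ext (funext fun x => map_add (starRingEnd ℂ) (f.1 x) (g.1 x)))
  map_smul' c f := Subtype.ext (Subtype.ext (funext fun x => map_mul (starRingEnd ℂ) c (f.1 x)))

/-- The embedding of `𝓢₀(K)` into `L²(K)` as a linear map. -/
noncomputable def toL2ₗ : meanZero μ →ₗ[ℂ] Lp ℂ 2 μ where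
  toFun := toL2 μ
  map_add' _ _ := rfl
  map_smul' _ _ := rfl

/-- Continuous functions that agree almost everywhere for Haar measure agree. This brings the
expansion back from L²(K) to 𝓢₀(K). -/
theorem toL2_injective : Function.Injective (toL2 μ) := by
  intro f g hfg
  have h1 := (MemLp.toLp_eq_toLp_iff _ _).1 hfg
  exact Subtype.ext (Subtype.ext
    ((f.1.continuous_coe.ae_eq_iff_eq μ g.1.continuous_coe).1 h1))

theorem inner_toL2 (f g : meanZero μ) :
    inner ℂ (toL2 μ f) (toL2 μ g) = toDual μ g (conjZero μ f) := by
  rw [L2.inner_def]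
  change _ = ∫ x, g.1 x * conj (f.1 x) ∂μ
  refine integral_congr_ae ?_
  filter_upwards [MemLp.coeFn_toLp (f.1.continuous_coe.memLp_of_hasCompactSupport (p := 2)
    (μ := μ) f.1.2.2), MemLp.coeFn_toLp (g.1.continuous_coe.memLp_of_hasCompactSupport (p := 2)
    (μ := μ) g.1.2.2)] with x hf hg
  rw [toL2, toL2, hf, hg, RCLike.inner_apply]

theorem toDual_conjZero_conjZero (f u : meanZero μ) :
    toDual μ (conjZero μ u) (conjZero μ f) = conj (toDual μ f u) := by
  change ∫ x, conj (u.1 x) * conj (f.1 x) ∂μ = conj (∫ x, f.1 x * u.1 x ∂μ)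
  rw [← integral_conj]
  simp_rw [map_mul, mul_comm]

/-- A tight frame of functions in `𝓢₀(K)` expands a function in `𝓢₀(K)` finitely, whenever only
finitely many coefficients are nonzero. -/
theorem IsTightFrame.smul_eq_sum_toDual {ι : Type*} {w : ι → meanZero μ} {C : ℝ}
    (h : IsTightFrame (fun i => toL2 μ (w i)) C) {u : meanZero μ} {s : Finset ι}
    (hs : ∀ i ∉ s, toDual μ (w i) u = 0) :
    (C : ℂ) • u = ∑ i ∈ s, toDual μ (w i) u • conjZero μ (w i) := by
  -- `toDual` is bilinear and the inner product sesquilinear, so the conjugate of u is expanded and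
  -- the result conjugated back.
  have hc : ∀ i, inner ℂ (toL2 μ (w i)) (toL2 μ (conjZero μ u)) = conj (toDual μ (w i) u) :=
    fun i => by rw [inner_toL2, toDual_conjZero_conjZero]
  have h1 := h.smul_eq_sum (x := toL2 μ (conjZero μ u)) (s := s)
    fun i hi => by rw [hc, hs i hi, map_zero]
  simp_rw [hc] at h1
  have h2 : (C : ℂ) • conjZero μ u = ∑ i ∈ s, conj (toDual μ (w i) u) • w i := by
    refine toL2_injective μ ?_
    change toL2ₗ μ _ = toL2ₗ μ _
    rw [map_smul, map_sum]
    simp_rw [map_smul]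
    exact h1
  have h3 := congrArg (conjZeroₛₗ μ) h2
  rw [map_smulₛₗ, map_sum] at h3
  simp_rw [map_smulₛₗ, Complex.conj_conj] at h3
  rw [Complex.conj_ofReal] at h3
  change (C : ℂ) • conjZero μ (conjZero μ u) = _ at h3
  rwa [conjZero_conjZero] at h3

/-- The analysis operator `φ ↦ (⟨φ | w i⟩)`. -/
noncomputable def analysis {ι : Type*} (w : ι → meanZero μ) : MeanZeroDual μ →L[ℂ] (ι → ℂ) where
  toFun φ i := pairing μ φ (w i)
  map_add' _ _ := rfl
  map_smul' _ _ := rfl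
  cont := continuous_pi fun i => WeakDual.eval_continuous (conjZero μ (w i))

end Expansion

/-! ### The discrete wavelet expansion. -/

theorem proposition6p6 {K : Type*} [Field K] [TopologicalSpace K] [IsTDLocalField K]
    [MeasurableSpace K] [BorelSpace K] (μ : Measure K) [μ.IsAddHaarMeasure] [μ.Regular]
    {m : ℕ} (g : Fin m → meanZero μ)
    (H : Subgroup (AffGroup K)) (hHc : IsCompact (H : Set (AffGroup K)))
    (hHo : IsOpen (H : Set (AffGroup K)))
    (R : Set (AffGroup K)) (hR : Subgroup.IsComplement R (H : Set (AffGroup K))) :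
    ∃ S : (R × Fin m → ℂ) →L[ℂ] MeanZeroDual μ,
      (∀ α : R × Fin m → ℂ,
        HasSum (fun p => α p • toDual μ (waveletSystem μ g R p)) (S α)) ∧
      (∀ p : R × Fin m, {q | reproducingKernel μ g R p q ≠ 0}.Finite) ∧
      ∃ T : (R × Fin m → ℂ) →L[ℂ] (R × Fin m → ℂ),
        (∀ (α : R × Fin m → ℂ) (p : R × Fin m),
          HasSum (fun q => reproducingKernel μ g R p q * α q) (T α p)) ∧
        ∀ C : ℝ, IsTightFrame (fun p => toL2 μ (waveletSystem μ g R p)) C →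
          ∃ W : MeanZeroDual μ ≃L[ℂ] reproducingSubspace T C,
            (∀ (φ : MeanZeroDual μ) (p : R × Fin m),
              (W φ : R × Fin m → ℂ) p = pairing μ φ (waveletSystem μ g R p)) ∧
            (∀ α : reproducingSubspace T C,
              W.symm α = (C : ℂ)⁻¹ • S (α : R × Fin m → ℂ)) ∧
            ∀ φ : MeanZeroDual μ,
              HasSum (fun p => (C : ℂ)⁻¹ • pairing μ φ (waveletSystem μ g R p) •
                toDual μ (waveletSystem μ g R p)) φ := by
  have hfin := finite_setOf_toDual_waveletSystem_ne_zero μ g hHo hR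
  have hker : ∀ p q, reproducingKernel μ g R p q =
      toDual μ (waveletSystem μ g R q) (conjZero μ (waveletSystem μ g R p)) :=
    fun p q => inner_toL2 μ _ _
  let S := synthesis (continuous_linearMap_submodule (meanZero μ))
    (fun p => toDual μ (waveletSystem μ g R p)) hfin
  have hS : ∀ α : R × Fin m → ℂ,
      HasSum (fun p => α p • toDual μ (waveletSystem μ g R p)) (S α) := hasSum_synthesis _ _ _
  let A := analysis μ (waveletSystem μ g R)
  -- T is taken to be A S, which makes its continuity automatic; its matrix is the reproducing
  -- kernel.
  refine ⟨S, hS, fun p => ?_, A.comp S, fun α p => ?_, fun C hC => ?_⟩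
  · simp_rw [hker]
    exact hfin _
  · have h1 := WeakDual.hasSum_iff.1 (hS α) (conjZero μ (waveletSystem μ g R p))
    simp_rw [hker, mul_comm]
    exact h1
  · have hC0 : (C : ℂ) ≠ 0 := Complex.ofReal_ne_zero.2 hC.1.ne'
    have hSA : ∀ φ : MeanZeroDual μ, (C : ℂ)⁻¹ • S (A φ) = φ := by
      intro φ
      rw [inv_smul_eq_iff₀ hC0]
      refine DFunLike.ext _ _ fun u => ?_
      have hs : ∀ p ∉ (hfin u).toFinset, toDual μ (waveletSystem μ g R p) u = 0 := by
        intro p hp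
        simpa using hp
      have h1 : HasSum (fun p => A φ p * toDual μ (waveletSystem μ g R p) u) (S (A φ) u) :=
        WeakDual.hasSum_iff.1 (hS (A φ)) u
      have h2 := hasSum_sum_of_ne_finset_zero (L := SummationFilter.unconditional _)
        (f := fun p => A φ p * toDual μ (waveletSystem μ g R p) u) (s := (hfin u).toFinset)
        fun p hp => by rw [hs p hp, mul_zero]
      rw [h1.unique h2]
      -- The expansion of C u is a finite sum in 𝓢₀(K), so φ passes through it by linearity alone.
      have h3 := congrArg φ (hC.smul_eq_sum_toDual μ hs)
      rw [map_smul, map_sum] at h3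
      change _ = (C : ℂ) • φ u
      rw [h3]
      refine Finset.sum_congr rfl fun p _ => ?_
      rw [map_smul, smul_eq_mul, mul_comm]
      rfl
    have hmem : ∀ φ : MeanZeroDual μ, A φ ∈ reproducingSubspace (A.comp S) C := by
      intro φ
      change A φ = (C : ℂ)⁻¹ • A (S (A φ))
      rw [← map_smul, hSA]
    -- One composite is the identity by `hSA`, the other by the equation defining the reproducing
    -- subspace.
    refine ⟨ContinuousLinearEquiv.equivOfInverse (A.codRestrict _ hmem)
      (((C : ℂ)⁻¹ • S).comp (Submodule.subtypeL _)) hSA fun α => Subtype.ext ?_,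
      fun _ _ => rfl, fun _ => rfl, fun φ => ?_⟩
    · change A ((C : ℂ)⁻¹ • S α.1) = α.1
      rw [map_smul]
      exact α.2.symm
    · have h1 := (hS (A φ)).const_smul (C : ℂ)⁻¹
      rw [hSA] at h1
      exact h1
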